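/- Let $E$ be a Polish space, and let $\mathcal P(E)$ be the set of Borel probability measures on $E$ with the topology of weak convergence. For $\nu,\mu\in\mathcal P(E)$ let $H(\nu|\mu)=\int_E\log(d\nu/d\mu)\,d\nu$ if $\nu\ll\mu$, and $H(\nu|\mu)=\infty$ otherwise. Let $M\subset\mathcal P(E)$ be nonempty, convex and weakly compact. For $n\ge 1$ let $M_n\subset\mathcal P(E^n)$ be the set of laws of $E^n$-valued random variables $(X_1,\dots,X_n)$ such that the law of $X_1$ belongs to $M$ and, for each $k=2,\dots,n$, the conditional law of $X_k$ given $(X_1,\dots,X_{k-1})$ belongs to $M$ almost surely. Let $L_n:E^n\to\mathcal P(E)$, $L_n(x_1,\dots,x_n)=\frac1n\sum_{i=1}^n\delta_{x_i}$, be the empirical measure. Then, with the conventions $\log 0=-\infty$ and $\inf\emptyset=+\infty$: 1. For every bounded continuous $F:\mathcal P(E)\to\mathbb R$, $$\lim_{n\to\infty}\ \sup_{\mu\in M_n}\frac1n\log\int_{E^n}e^{nF\circ L_n}\,d\mu=\sup_{\nu\in\mathcal P(E),\ \mu\in M}\bigl(F(\nu)-H(\nu|\mu)\bigr).$$ 2.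 For every closed set $A\subset\mathcal P(E)$, $$\limsup_{n\to\infty}\ \sup_{\mu\in M_n}\frac1n\log\mu(L_n\in A)\le-\inf\{H(\nu|\mu):\nu\in A,\ \mu\in M\}.$$ -/

import Mathlib

open MeasureTheory ProbabilityTheory Filter Topology
open scoped ENNReal NNReal BoundedContinuousFunction

noncomputable section

namespace UniformSanov

variable {E : Type*} [MeasurableSpace E]

/-- The empirical measure `L_n(x) = (1/n) ∑ δ_{x_i}` of a point `x ∈ E^n`, for `n ≥ 1`. -/
def empiricalMeasure {n : ℕ} [NeZero n] (x : Fin n → E) : ProbabilityMeasure E :=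
  ⟨(n : ℝ≥0∞)⁻¹ • ∑ i, Measure.dirac (x i), ⟨by
    simp only [Measure.smul_apply, Measure.finsetSum_apply, measure_univ, Finset.sum_const,
      Finset.card_univ, Fintype.card_fin, nsmul_eq_mul, mul_one, smul_eq_mul]
    exact ENNReal.inv_mul_cancel (by exact_mod_cast NeZero.ne n) (ENNReal.natCast_ne_top n)⟩⟩

/-- The coordinates of `x ∈ E^n` that strictly precede the coordinate `k`
(coordinates are numbered from `0`, so that there are `k` of them). -/
def past {n : ℕ} (k : Fin n) (x : Fin n → E) : Fin k → E :=
  fun i => x (Fin.castLE k.isLt.le i)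

/-- `κ` is a regular conditional law of the coordinate `k` given the preceding coordinates
under `μ`: it is a Markov kernel, and the joint law of (preceding coordinates, coordinate `k`)
is `(law of the preceding coordinates)(dy) κ(y)(dz)`. For `k = 0` the preceding coordinates form
the single point of `E^0`, and `κ` is the law of the first coordinate. -/
def IsConditionalLaw {n : ℕ} (μ : Measure (Fin n → E)) (k : Fin n)
    (κ : Kernel (Fin k → E) E) : Prop :=
  IsMarkovKernel κ ∧ μ.map (fun x => (past k x, x k)) = (μ.map (past k)) ⊗ₘ κ

/-- The set `M_n` of the laws on `E^n` for which the law of the first coordinate and, almost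
surely, the conditional law of each later coordinate given the preceding ones, belong to `M`. -/
def conditionalLaws (M : Set (ProbabilityMeasure E)) (n : ℕ) :
    Set (ProbabilityMeasure (Fin n → E)) :=
  {μ | ∀ k : Fin n, ∃ κ : Kernel (Fin k → E) E, IsConditionalLaw (μ : Measure (Fin n → E)) k κ ∧
    ∀ᵐ x ∂(μ : Measure (Fin n → E)), ∃ ν ∈ M, (ν : Measure E) = κ (past k x)}

/-- Convexity of a set of probability measures, under mixtures `a μ + b ν`, `a + b = 1`. -/
def IsConvex (M : Set (ProbabilityMeasure E)) : Prop :=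
  Convex ℝ≥0 ((fun μ : ProbabilityMeasure E => (μ : Measure E)) '' M)

/-- The relative entropy `H(ν | μ)`, that is `∫ log (dν/dμ) dν` if `ν ≪ μ` and `∞` otherwise,
as an extended real number. -/
def relEntropy (ν μ : ProbabilityMeasure E) : EReal :=
  (InformationTheory.klDiv (ν : Measure E) (μ : Measure E) : EReal)

end UniformSanov

end

noncomputable section

namespace UniformSanov

/-! Upper bound. Suppose every entropy `H(ν|μ)`, `μ ∈ M`, exceeds `a`. The Donsker-Varadhan formula
gives for each `μ` a bounded continuous `f` with `∫ f dν = a` and `∫ exp f dμ < 1`. By compactness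
of `M` finitely many such `f` suffice, and by convexity of `M` and Hahn-Banach some convex
combination of them satisfies `∫ exp f dμ ≤ 1` for all `μ ∈ M` at once (`exists_testFunction`).
Conditioning one coordinate at a time, every law in `M_n` gives `exp (∑ f(x_i))` expectation at most
`1` (`lintegral_prod_le`), so Chernoff's bound controls `L_n` near `ν` at rate almost `a`
(`exists_isOpen_lintegral_le`). Tightness of `M` makes the empirical measures exponentially tight,
uniformly over `M_n` (`exists_isCompact_measure_compl_le`); a finite cover of a compact set then
gives `exists_lintegral_le`, for a closed set and a bounded continuous `F` together. The Laplace
upper bound is the case of the whole space, the large deviation bound the case `F = 0`.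

Lower bound. For `μ ∈ M` the i.i.d. law `μ^n` lies in `M_n`. Changing measure from `μ^n` to `ν^n`
and applying Jensen costs exactly `n H(ν|μ)` (`ofReal_exp_le_lintegral_pi`), and under `ν^n` the
weak law of large numbers sends the mean of `F ∘ L_n` to `F ν`. -/

/-! ### Truncated logarithms -/

/-- The logarithm truncated to the interval `[-t, t]`, with value `-t` at zero. -/
def truncLog (t x : ℝ) : ℝ := Real.log (max (Real.exp (-t)) (min x (Real.exp t)))

lemma measurable_truncLog (t : ℝ) : Measurable (truncLog t) := by
  unfold truncLog; fun_prop

lemma exp_truncLog (t x : ℝ) :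
    Real.exp (truncLog t x) = max (Real.exp (-t)) (min x (Real.exp t)) :=
  Real.exp_log (lt_max_of_lt_left (Real.exp_pos _))

lemma abs_truncLog_le {t : ℝ} (ht : 0 ≤ t) (x : ℝ) : |truncLog t x| ≤ t := by
  rw [abs_le]
  constructor
  · rw [← Real.exp_le_exp, exp_truncLog]
    exact le_max_left _ _
  · rw [← Real.exp_le_exp, exp_truncLog]
    exact max_le (Real.exp_le_exp.2 (by linarith)) (min_le_right _ _)

-- Below `exp t` truncation can only raise the logarithm, so `klFun_nonneg` applies; above it the
-- value is `x (t - 1) + 1`, whence `1 ≤ t`. This sign is what makes Fatou's lemma available.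
open InformationTheory in
lemma truncLog_klFun_nonneg {t x : ℝ} (ht : 1 ≤ t) (hx : 0 ≤ x) :
    0 ≤ x * truncLog t x + 1 - x := by
  rcases hx.eq_or_lt with rfl | hx0
  · simp
  rcases le_total x (Real.exp t) with h | h
  · have h1 : Real.log x ≤ truncLog t x := by
      rw [truncLog, min_eq_left h]
      exact Real.log_le_log hx0 (le_max_right _ _)
    have h2 := klFun_nonneg hx
    rw [klFun_apply] at h2
    nlinarith [mul_le_mul_of_nonneg_left h1 hx]
  · rw [truncLog, min_eq_right h, max_eq_right (by gcongr; linarith), Real.log_exp]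
    nlinarith

open InformationTheory in
lemma tendsto_truncLog_klFun {x : ℝ} (hx : 0 ≤ x) :
    Tendsto (fun k : ℕ => x * truncLog (k + 1) x + 1 - x) atTop (𝓝 (klFun x)) := by
  have ht : Tendsto (fun k : ℕ => (k : ℝ) + 1) atTop atTop :=
    tendsto_atTop_add_const_right _ _ tendsto_natCast_atTop_atTop
  rcases hx.eq_or_lt with rfl | hx0
  · simp [klFun_apply]
  · refine tendsto_const_nhds.congr' ?_
    filter_upwards [ht.eventually_ge_atTop |Real.log x|] with k hk
    have h1 : x ≤ Real.exp (k + 1) := by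
      rw [← Real.log_le_iff_le_exp hx0]; exact (le_abs_self _).trans hk
    have h2 : Real.exp (-((k : ℝ) + 1)) ≤ x := by
      rw [← Real.le_log_iff_exp_le hx0]; linarith [neg_abs_le (Real.log x)]
    rw [truncLog, min_eq_left h1, max_eq_right h2, klFun_apply]

/-! ### The Donsker-Varadhan variational formula -/

section DonskerVaradhan

variable {E : Type*} [MeasurableSpace E]

lemma integrable_of_abs_le {μ : Measure E} [IsFiniteMeasure μ] {f : E → ℝ} (hf : Measurable f)
    {B : ℝ} (hB : ∀ x, |f x| ≤ B) : Integrable f μ :=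
  Integrable.of_bound hf.aestronglyMeasurable B (Eventually.of_forall hB)

-- The optimal test function `log (dν/dμ)` may be unbounded, so its truncations are used: Fatou
-- shows that their `ν`-integrals eventually exceed any `c` below the entropy, while truncation from
-- below adds at most `exp (-(k + 1))` to the exponential moment `1`.
open InformationTheory in
lemma exists_measurable_of_ac {ν μ : Measure E} [IsProbabilityMeasure ν] [IsProbabilityMeasure μ]
    (hac : ν ≪ μ) {a : ℝ} (ha0 : 0 ≤ a) (ha : ENNReal.ofReal a < klDiv ν μ) :
    ∃ (f : E → ℝ) (B : ℝ), Measurable f ∧ (∀ x, |f x| ≤ B) ∧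
      ∫ x, Real.exp (f x) ∂μ < Real.exp (∫ x, f x ∂ν - a) := by
  obtain ⟨c, hc0, hac', hc⟩ := ENNReal.lt_iff_exists_real_btwn.1 ha
  have hac' : a < c := by
    rwa [ENNReal.ofReal_lt_ofReal_iff_of_nonneg ha0] at hac'
  set ρ : E → ℝ := fun x => (ν.rnDeriv μ x).toReal with hρ
  have hρm : Measurable ρ := (Measure.measurable_rnDeriv _ _).ennreal_toReal
  have hρ0 : ∀ x, 0 ≤ ρ x := fun x => ENNReal.toReal_nonneg
  have hρi : Integrable ρ μ := Measure.integrable_toReal_rnDeriv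
  have hρ1 : ∫ x, ρ x ∂μ = 1 := by
    rw [hρ, Measure.integral_toReal_rnDeriv hac]; simp
  set f : ℕ → E → ℝ := fun k x => truncLog (k + 1) (ρ x) with hf
  have hfm : ∀ k, Measurable (f k) := fun k => (measurable_truncLog _).comp hρm
  have hfb : ∀ k x, |f k x| ≤ (k : ℝ) + 1 := fun k x => abs_truncLog_le (by positivity) _
  have hint : ∀ k, Integrable (fun x => ρ x * f k x) μ := fun k =>
    hρi.mul_bdd (hfm k).aestronglyMeasurable (Eventually.of_forall (hfb k))
  -- The added `1 - ρ` makes the integrand nonnegative and integrates to zero.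
  have hνf : ∀ k, ∫⁻ x, ENNReal.ofReal (ρ x * f k x + 1 - ρ x) ∂μ
      = ENNReal.ofReal (∫ x, f k x ∂ν) := by
    intro k
    rw [← ofReal_integral_eq_lintegral_ofReal]
    · congr 1
      have hint' : Integrable (fun x => ρ x * f k x + 1) μ := (hint k).add (integrable_const _)
      rw [integral_sub hint' hρi, integral_add (hint k) (integrable_const _), hρ1]
      have := integral_rnDeriv_smul (μ := ν) (ν := μ) hac (f := f k)
      simp only [smul_eq_mul] at this
      simp [← this, hρ]
    · exact ((hint k).add (integrable_const _)).sub hρi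
    · exact Eventually.of_forall fun x =>
        truncLog_klFun_nonneg (by linarith [k.cast_nonneg (α := ℝ)]) (hρ0 x)
  have hfatou : klDiv ν μ ≤ liminf (fun k => ENNReal.ofReal (∫ x, f k x ∂ν)) atTop := by
    rw [klDiv_eq_lintegral_klFun_of_ac hac]
    simp_rw [← hνf]
    refine le_trans (le_of_eq ?_) (lintegral_liminf_le fun k => ?_)
    · refine lintegral_congr fun x => ?_
      exact ((ENNReal.continuous_ofReal.tendsto _).comp
        (tendsto_truncLog_klFun (hρ0 x))).liminf_eq.symm
    · have := hfm k; fun_prop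
  have hev : ∀ᶠ k in atTop, ENNReal.ofReal c < ENNReal.ofReal (∫ x, f k x ∂ν) :=
    eventually_lt_of_lt_liminf (hc.trans_le hfatou)
  have hexp : Tendsto (fun k : ℕ => 1 + Real.exp (-((k : ℝ) + 1))) atTop (𝓝 (1 + 0)) := by
    refine tendsto_const_nhds.add ?_
    exact Real.tendsto_exp_neg_atTop_nhds_zero.comp
      (tendsto_atTop_add_const_right _ _ tendsto_natCast_atTop_atTop)
  have h1 : 1 + 0 < Real.exp (c - a) := by simpa using hac'
  obtain ⟨k, hk1, hk2⟩ := (hev.and (hexp.eventually_lt_const h1)).exists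
  refine ⟨f k, k + 1, hfm k, hfb k, ?_⟩
  have hk3 : c < ∫ x, f k x ∂ν := by
    rwa [ENNReal.ofReal_lt_ofReal_iff_of_nonneg hc0] at hk1
  calc ∫ x, Real.exp (f k x) ∂μ ≤ ∫ x, (ρ x + Real.exp (-((k : ℝ) + 1))) ∂μ := by
        refine integral_mono_of_nonneg (Eventually.of_forall fun x => (Real.exp_pos _).le)
          (hρi.add (integrable_const _)) (Eventually.of_forall fun x => ?_)
        simp only [hf, exp_truncLog]
        refine max_le ?_ ?_
        · linarith [hρ0 x]
        · exact (min_le_left _ _).trans (by linarith [Real.exp_pos (-((k : ℝ) + 1))])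
    _ = 1 + Real.exp (-((k : ℝ) + 1)) := by
        rw [integral_add hρi (integrable_const _), hρ1]; simp
    _ < Real.exp (c - a) := hk2
    _ < _ := by gcongr

/-- A large multiple of the indicator of a `μ`-null set charged by `ν` is invisible to `μ`; the
height is chosen so that its `ν`-integral is `a + 1`. -/
lemma exists_measurable_of_not_ac {ν μ : Measure E} [IsProbabilityMeasure ν]
    [IsProbabilityMeasure μ] (hac : ¬ ν ≪ μ) (a : ℝ) :
    ∃ (f : E → ℝ) (B : ℝ), Measurable f ∧ (∀ x, |f x| ≤ B) ∧
      ∫ x, Real.exp (f x) ∂μ < Real.exp (∫ x, f x ∂ν - a) := by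
  obtain ⟨s, hs, hμ, hν⟩ : ∃ s, MeasurableSet s ∧ μ s = 0 ∧ ν s ≠ 0 := by
    by_contra! h
    exact hac (Measure.AbsolutelyContinuous.mk fun s hs hμ => h s hs hμ)
  have hp : 0 < ν.real s := by
    rw [measureReal_def]; exact ENNReal.toReal_pos hν (measure_ne_top _ _)
  set T : ℝ := (a + 1) / ν.real s with hT
  refine ⟨s.indicator fun _ => T, |T|, measurable_const.indicator hs, fun x => ?_, ?_⟩
  · by_cases hx : x ∈ s <;> simp [hx]
  · have h1 : ∫ x, Real.exp (s.indicator (fun _ => T) x) ∂μ = 1 := by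
      have : (fun x => Real.exp (s.indicator (fun _ => T) x)) =ᵐ[μ] fun _ => 1 := by
        have : ∀ᵐ x ∂μ, x ∉ s := measure_eq_zero_iff_ae_notMem.1 hμ
        filter_upwards [this] with x hx
        simp [hx]
      rw [integral_congr_ae this]; simp
    have h2 : ∫ x, s.indicator (fun _ => T) x ∂ν = a + 1 := by
      rw [integral_indicator_const _ hs, smul_eq_mul, hT]; field_simp
    rw [h1, h2]
    simp

open InformationTheory in
/-- Donsker-Varadhan: the relative entropy is at most the supremum of
`∫ f dν - log ∫ exp f dμ` over bounded measurable `f`. -/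
lemma exists_measurable_of_lt_klDiv {ν μ : Measure E} [IsProbabilityMeasure ν]
    [IsProbabilityMeasure μ] {a : ℝ} (ha : (a : EReal) < (klDiv ν μ : EReal)) :
    ∃ (f : E → ℝ) (B : ℝ), Measurable f ∧ (∀ x, |f x| ≤ B) ∧
      ∫ x, Real.exp (f x) ∂μ < Real.exp (∫ x, f x ∂ν - a) := by
  by_cases hac : ν ≪ μ
  · rcases lt_or_ge a 0 with h | h
    · exact ⟨fun _ => 0, 0, measurable_const, by simp, by simpa using h⟩
    · refine exists_measurable_of_ac hac h ?_
      rw [← EReal.coe_ennreal_lt_coe_ennreal_iff, EReal.coe_ennreal_ofReal, max_eq_left h]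
      exact ha
  · exact exists_measurable_of_not_ac hac a

open InformationTheory in
/-- Donsker-Varadhan: the relative entropy is at most the supremum of
`∫ f dν - log ∫ exp f dμ` over bounded continuous `f`. -/
lemma exists_boundedContinuous_of_lt_klDiv [TopologicalSpace E] [PolishSpace E] [BorelSpace E]
    {ν μ : Measure E} [IsProbabilityMeasure ν] [IsProbabilityMeasure μ] {a : ℝ}
    (ha : (a : EReal) < (klDiv ν μ : EReal)) :
    ∃ f : E →ᵇ ℝ, ∫ x, Real.exp (f x) ∂μ < Real.exp (∫ x, f x ∂ν - a) := by
  let _ := TopologicalSpace.upgradeIsCompletelyMetrizable E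
  obtain ⟨f, B, hf, hfB, hlt⟩ := exists_measurable_of_lt_klDiv ha
  -- An `L¹` error `δ` costs `δ` in the `ν`-integral and `exp B * δ` in the exponential moment; the
  -- strict inequality survives for small `δ`.
  have hcont : Tendsto (fun δ : ℝ => Real.exp (∫ x, f x ∂ν - δ - a) -
      (∫ x, Real.exp (f x) ∂μ + Real.exp B * δ)) (𝓝[>] 0)
      (𝓝 (Real.exp (∫ x, f x ∂ν - 0 - a) - (∫ x, Real.exp (f x) ∂μ + Real.exp B * 0))) := by
    refine Tendsto.mono_left (Continuous.tendsto ?_ 0) nhdsWithin_le_nhds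
    fun_prop
  obtain ⟨δ, hδ, hδ0⟩ := ((hcont.eventually_const_lt (u := 0) (by simpa using hlt)).and
    self_mem_nhdsWithin).exists
  have hδ0 : 0 < δ := hδ0
  obtain ⟨g, hg, -⟩ := (integrable_of_abs_le hf hfB (μ := ν + μ)
    ).exists_boundedContinuous_integral_sub_le hδ0
  -- Clipping to `[-B, B]` does not increase the distance to `f`, and it bounds `exp h` by `exp B`.
  set h : E →ᵇ ℝ := BoundedContinuousFunction.ofNormedAddCommGroup
    (fun x => max (-B) (min B (g x))) (by fun_prop) |B| (fun x => by
      have hB : 0 ≤ B := (abs_nonneg _).trans (hfB x)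
      rw [Real.norm_eq_abs, abs_of_nonneg hB, abs_le]
      exact ⟨le_max_left _ _, max_le (by linarith) (min_le_left _ _)⟩) with hh
  have hhx : ∀ x, h x = max (-B) (min B (g x)) := fun x => rfl
  have hle : ∀ x, |f x - h x| ≤ |f x - g x| := by
    intro x
    have := abs_le.1 (hfB x)
    rw [hhx]
    rcases le_total (g x) (-B) with h1 | h1
    · rw [min_eq_right (by linarith), max_eq_left h1, abs_of_nonneg (by linarith),
        abs_of_nonneg (by linarith)]
      linarith
    rcases le_total (g x) B with h2 | h2
    · rw [min_eq_right h2, max_eq_right h1]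
    · rw [min_eq_left h2, max_eq_right (by linarith), abs_of_nonpos (by linarith),
        abs_of_nonpos (by linarith)]
      linarith
  have hif : ∀ m : Measure E, [IsFiniteMeasure m] → Integrable f m :=
    fun m _ => integrable_of_abs_le hf hfB
  have hdiff : ∀ m : Measure E, [IsFiniteMeasure m] → m ≤ ν + μ →
      ∫ x, |f x - h x| ∂m ≤ δ := by
    intro m _ hm
    have hi : Integrable (fun x => ‖f x - g x‖) (ν + μ) :=
      ((hif _).sub (g.integrable _)).norm
    calc ∫ x, |f x - h x| ∂m ≤ ∫ x, ‖f x - g x‖ ∂m :=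
          integral_mono ((hif m).sub (h.integrable m)).norm (hi.mono_measure hm) hle
      _ ≤ ∫ x, ‖f x - g x‖ ∂(ν + μ) :=
          integral_mono_measure hm (Eventually.of_forall fun x => norm_nonneg _) hi
      _ ≤ δ := hg
  refine ⟨h, ?_⟩
  have h1 : ∫ x, f x ∂ν - δ ≤ ∫ x, h x ∂ν := by
    have := hdiff ν (Measure.le_add_right le_rfl)
    have h2 : ∫ x, f x - h x ∂ν ≤ ∫ x, |f x - h x| ∂ν :=
      integral_mono ((hif ν).sub (h.integrable ν)) ((hif ν).sub (h.integrable ν)).abs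
        fun x => le_abs_self _
    rw [integral_sub (hif ν) (h.integrable ν)] at h2
    linarith
  have hexpf : Integrable (fun x => Real.exp (f x)) μ :=
    integrable_of_abs_le (by fun_prop) (B := Real.exp B) fun x => by
      rw [Real.abs_exp]; exact Real.exp_le_exp.2 (abs_le.1 (hfB x)).2
  have hidiff : Integrable (fun x => |f x - h x|) μ := ((hif μ).sub (h.integrable μ)).abs
  have h2 : ∫ x, Real.exp (h x) ∂μ ≤ ∫ x, Real.exp (f x) ∂μ + Real.exp B * δ := by
    calc ∫ x, Real.exp (h x) ∂μ ≤ ∫ x, (Real.exp (f x) + Real.exp B * |f x - h x|) ∂μ := by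
          refine integral_mono_of_nonneg (Eventually.of_forall fun x => (Real.exp_pos _).le)
            (hexpf.add (hidiff.const_mul _))
            (Eventually.of_forall fun x => ?_)
          have h3 : Real.exp (h x) * (1 + (f x - h x)) ≤ Real.exp (f x) := by
            calc _ ≤ Real.exp (h x) * Real.exp (f x - h x) := by
                  gcongr; linarith [Real.add_one_le_exp (f x - h x)]
              _ = _ := by rw [← Real.exp_add]; ring_nf
          have h4 : Real.exp (h x) * |f x - h x| ≤ Real.exp B * |f x - h x| := by
            gcongr
            have := abs_le.1 (hfB x)
            exact max_le (by linarith) (min_le_left _ _)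
          have h5 : Real.exp (h x) * (-(f x - h x)) ≤ Real.exp (h x) * |f x - h x| := by
            gcongr; exact neg_le_abs _
          simp only
          linarith
      _ = ∫ x, Real.exp (f x) ∂μ + Real.exp B * ∫ x, |f x - h x| ∂μ := by
          rw [integral_add hexpf (hidiff.const_mul _),
            integral_const_mul]
      _ ≤ _ := by gcongr; exact hdiff μ (Measure.le_add_left le_rfl)
  calc _ ≤ _ := h2
    _ < Real.exp (∫ x, f x ∂ν - δ - a) := by linarith
    _ ≤ _ := by gcongr

end DonskerVaradhan

/-! ### One test function for all of `M` -/

section Minimax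

lemma IsConvex.exists_mix {E : Type*} [MeasurableSpace E] {M : Set (ProbabilityMeasure E)} (hM : IsConvex M)
    {μ₁ μ₂ : ProbabilityMeasure E} (h₁ : μ₁ ∈ M) (h₂ : μ₂ ∈ M) {s t : ℝ} (hs : 0 ≤ s) (ht : 0 ≤ t)
    (hst : s + t = 1) :
    ∃ μ ∈ M, (μ : Measure E) = s.toNNReal • (μ₁ : Measure E) + t.toNNReal • (μ₂ : Measure E) := by
  obtain ⟨μ, hμ, h⟩ := hM (Set.mem_image_of_mem _ h₁) (Set.mem_image_of_mem _ h₂)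
    (a := s.toNNReal) (b := t.toNNReal) zero_le zero_le
    (by rw [← Real.toNNReal_add hs ht, hst, Real.toNNReal_one])
  exact ⟨μ, hμ, h⟩

variable {E : Type*} [TopologicalSpace E]

/-- The exponential of a bounded continuous function, as a bounded continuous function. -/
def expBCF (f : E →ᵇ ℝ) : E →ᵇ ℝ :=
  BoundedContinuousFunction.ofNormedAddCommGroup (fun x => Real.exp (f x)) (by fun_prop)
    (Real.exp ‖f‖) fun x => by
      rw [Real.norm_eq_abs, Real.abs_exp]
      exact Real.exp_le_exp.2 ((le_abs_self _).trans (f.norm_coe_le_norm x))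

@[simp] lemma expBCF_apply (f : E →ᵇ ℝ) (x : E) : expBCF f x = Real.exp (f x) := rfl

/-- A finite-dimensional convex compact set of vectors, each of which has an entry less than `1`,
admits weights for which all weighted averages of the entries are at most `1`. -/
lemma exists_weights {ι : Type*} [Fintype ι] {C : Set (ι → ℝ)} (hne : C.Nonempty)
    (hconv : Convex ℝ C) (hcomp : IsCompact C) (hlt : ∀ p ∈ C, ∃ i, p i < 1) :
    ∃ w : ι → ℝ, (∀ i, 0 ≤ w i) ∧ ∑ i, w i = 1 ∧ ∀ p ∈ C, ∑ i, w i * p i ≤ 1 := by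
  classical
  -- The weights are the normalised coefficients of a functional separating `C` from the orthant
  -- above `1`.
  have hdisj : Disjoint C (Set.Ici (1 : ι → ℝ)) := by
    rw [Set.disjoint_left]
    intro p hp hp1
    obtain ⟨i, hi⟩ := hlt p hp
    exact absurd (hp1 i) (not_le.2 hi)
  obtain ⟨φ, u, v, hu, huv, hv⟩ := geometric_hahn_banach_compact_closed hconv hcomp
    (convex_Ici _) isClosed_Ici hdisj
  set l : ι → ℝ := fun i => φ (Pi.single i 1) with hl
  have hφ : ∀ p, φ p = ∑ i, l i * p i := by
    intro p
    have := LinearMap.pi_apply_eq_sum_univ (φ : (ι → ℝ) →ₗ[ℝ] ℝ) p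
    rw [ContinuousLinearMap.coe_coe] at this
    rw [this]
    refine Finset.sum_congr rfl fun i _ => ?_
    rw [smul_eq_mul, mul_comm, hl]
    congr 2
    ext j
    simp [Pi.single_apply, eq_comm]
  have h1 : v < φ 1 := hv 1 (Set.mem_Ici.2 le_rfl)
  have hl0 : ∀ i, 0 ≤ l i := by
    intro i
    by_contra! hi
    -- Moving this far along axis `i` stays in the orthant but brings `φ` down to exactly `v`.
    have hr : 0 ≤ (φ 1 - v) / (-l i) := div_nonneg (by linarith) (by linarith)
    have := hv (1 + ((φ 1 - v) / (-l i)) • Pi.single i 1) (by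
      rw [Set.mem_Ici, le_add_iff_nonneg_right]
      exact smul_nonneg hr (Pi.single_nonneg.2 zero_le_one))
    rw [map_add, map_smul, smul_eq_mul] at this
    change v < φ 1 + (φ 1 - v) / (-l i) * l i at this
    rw [div_neg, neg_mul, div_mul_cancel₀ _ hi.ne] at this
    linarith
  have hsum : φ 1 = ∑ i, l i := by simp [hφ]
  have hpos : 0 < ∑ i, l i := by
    refine lt_of_le_of_ne (Finset.sum_nonneg fun i _ => hl0 i) fun h0 => ?_
    have hz := (Finset.sum_eq_zero_iff_of_nonneg fun i _ => hl0 i).1 h0.symm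
    obtain ⟨p, hp⟩ := hne
    have h2 := hu p hp
    have : φ p = 0 := by
      rw [hφ]; exact Finset.sum_eq_zero fun i hi => by rw [hz i hi, zero_mul]
    rw [hsum, ← h0] at h1
    linarith
  refine ⟨fun i => l i / ∑ j, l j, fun i => div_nonneg (hl0 i) hpos.le, ?_, fun p hp => ?_⟩
  · rw [← Finset.sum_div, div_self hpos.ne']
  · have : ∑ i, l i / (∑ j, l j) * p i = φ p / ∑ j, l j := by
      rw [hφ, Finset.sum_div]
      exact Finset.sum_congr rfl fun i _ => by ring
    rw [this, div_le_one hpos, ← hsum]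
    linarith [hu p hp]

variable [MeasurableSpace E] [PolishSpace E] [BorelSpace E]

/-- If all relative entropies of `ν` with respect to members of the convex compact set `M` exceed
`a`, then a single test function witnesses that they are all at least `a`. -/
lemma exists_testFunction {M : Set (ProbabilityMeasure E)} (hMne : M.Nonempty) (hMconv : IsConvex M)
    (hMcomp : IsCompact M) {ν : ProbabilityMeasure E} {a : ℝ}
    (h : ∀ μ ∈ M, (a : EReal) < relEntropy ν μ) :
    ∃ f : E →ᵇ ℝ, ∫ x, f x ∂(ν : Measure E) = a ∧
      ∀ μ ∈ M, ∫ x, Real.exp (f x) ∂(μ : Measure E) ≤ 1 := by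
  have hcont : ∀ f : E →ᵇ ℝ, Continuous fun μ : ProbabilityMeasure E =>
      ∫ x, Real.exp (f x) ∂(μ : Measure E) := fun f =>
    ProbabilityMeasure.continuous_integral_boundedContinuousFunction (expBCF f)
  obtain ⟨t, ht⟩ := hMcomp.elim_finite_subcover
    (fun f : {f : E →ᵇ ℝ // ∫ x, f x ∂(ν : Measure E) = a} =>
      {μ : ProbabilityMeasure E | ∫ x, Real.exp (f.1 x) ∂(μ : Measure E) < 1})
    (fun f => isOpen_lt (hcont f.1) continuous_const) (by
      intro μ hμ
      obtain ⟨g, hg⟩ := exists_boundedContinuous_of_lt_klDiv (h μ hμ)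
      -- Adding a constant makes the `ν`-integral exactly `a`, a condition preserved by convex
      -- combinations.
      set c : ℝ := a - ∫ x, g x ∂(ν : Measure E) with hc
      refine Set.mem_iUnion.2 ⟨⟨g + BoundedContinuousFunction.const E c, ?_⟩, ?_⟩
      · simp only [BoundedContinuousFunction.coe_add, Pi.add_apply,
          BoundedContinuousFunction.const_apply]
        rw [integral_add (g.integrable _) (integrable_const _)]
        simp [hc]
      · simp only [Set.mem_ofPred_eq, BoundedContinuousFunction.coe_add, Pi.add_apply,
          BoundedContinuousFunction.const_apply, Real.exp_add]
        rw [integral_mul_const]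
        calc _ < Real.exp (∫ x, g x ∂(ν : Measure E) - a) * Real.exp c := by gcongr
          _ = 1 := by rw [← Real.exp_add, hc]; simp)
  set Φ : ProbabilityMeasure E → t → ℝ := fun μ f => ∫ x, Real.exp (f.1.1 x) ∂(μ : Measure E)
    with hΦ
  have hint : ∀ (f : E →ᵇ ℝ) (μ : Measure E) [IsFiniteMeasure μ],
      Integrable (fun x => Real.exp (f x)) μ := fun f μ _ => (expBCF f).integrable μ
  obtain ⟨w, hw0, hw1, hw⟩ := exists_weights (C := Φ '' M) (hMne.image _) (by
      rintro _ ⟨μ₁, h₁, rfl⟩ _ ⟨μ₂, h₂, rfl⟩ r s hr hs hrs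
      obtain ⟨μ, hμ, hμe⟩ := hMconv.exists_mix h₁ h₂ hr hs hrs
      refine ⟨μ, hμ, ?_⟩
      ext f
      simp only [hΦ, hμe, Pi.add_apply, Pi.smul_apply, smul_eq_mul]
      rw [integral_add_measure (hint _ _) (hint _ _), integral_smul_nnreal_measure,
        integral_smul_nnreal_measure]
      simp [NNReal.smul_def, hr, hs])
    (hMcomp.image (continuous_pi fun f => hcont _)) (by
      rintro _ ⟨μ, hμ, rfl⟩
      obtain ⟨f, hf, hlt⟩ := Set.mem_iUnion₂.1 (ht hμ)
      exact ⟨⟨f, hf⟩, hlt⟩)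
  refine ⟨∑ f, w f • f.1.1, ?_, fun μ hμ => ?_⟩
  · simp only [BoundedContinuousFunction.coe_sum, Finset.sum_apply,
      BoundedContinuousFunction.coe_smul, smul_eq_mul]
    rw [integral_finsetSum _ fun f _ => (f.1.1.integrable _).const_mul _]
    simp_rw [integral_const_mul, fun f : t => f.1.2, ← Finset.sum_mul, hw1, one_mul]
  · calc _ ≤ ∫ x, ∑ f, w f * Real.exp (f.1.1 x) ∂(μ : Measure E) := by
          refine integral_mono (hint _ _)
            (integrable_finsetSum _ fun f _ => (hint _ _).const_mul _) fun x => ?_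
          simp only [BoundedContinuousFunction.coe_sum, Finset.sum_apply,
            BoundedContinuousFunction.coe_smul]
          exact convexOn_exp.map_sum_le (fun f _ => hw0 f) hw1 fun _ _ => Set.mem_univ _
      _ = ∑ f, w f * Φ μ f := by
          rw [integral_finsetSum _ fun f _ => (hint _ _).const_mul _]
          simp_rw [integral_const_mul, hΦ]
      _ ≤ 1 := hw _ (Set.mem_image_of_mem _ hμ)

end Minimax

/-! ### Empirical measures and exponential moments under laws in `M_n` -/

section Empirical

variable {E : Type*} [MeasurableSpace E]

lemma measurable_past {n : ℕ} (k : Fin n) : Measurable (past (E := E) k) := by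
  unfold past; fun_prop

lemma toMeasure_empiricalMeasure {n : ℕ} [NeZero n] (x : Fin n → E) :
    (empiricalMeasure x : Measure E) = (n : ℝ≥0∞)⁻¹ • ∑ i, Measure.dirac (x i) := rfl

lemma integral_empiricalMeasure {n : ℕ} [NeZero n] (x : Fin n → E) {f : E → ℝ}
    (hf : Measurable f) :
    ∫ y, f y ∂(empiricalMeasure x : Measure E) = (n : ℝ)⁻¹ * ∑ i, f (x i) := by
  rw [toMeasure_empiricalMeasure, integral_smul_measure, integral_finsetSum_measure]
  · simp [integral_dirac' _ _ hf.stronglyMeasurable]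
  · intro i _
    exact (integrable_dirac' hf.stronglyMeasurable (by simp))

lemma continuous_empiricalMeasure [TopologicalSpace E] [BorelSpace E]
    {n : ℕ} [NeZero n] : Continuous (empiricalMeasure (E := E) (n := n)) := by
  rw [continuous_iff_continuousAt]
  intro x
  rw [ContinuousAt, ProbabilityMeasure.tendsto_iff_forall_integral_tendsto]
  intro f
  simp_rw [integral_empiricalMeasure _ f.continuous.measurable]
  refine Continuous.tendsto ?_ x
  fun_prop

/-- Iterated conditioning: product functionals under a law in `M_n` are bounded as if the
coordinates were independent. -/
lemma lintegral_prod_le {M : Set (ProbabilityMeasure E)} {n : ℕ}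
    {μ : ProbabilityMeasure (Fin n → E)} (hμ : μ ∈ conditionalLaws M n) {f : E → ℝ≥0∞}
    (hf : Measurable f) {C : ℝ≥0∞} (hC : ∀ ν ∈ M, ∫⁻ y, f y ∂(ν : Measure E) ≤ C) (k : ℕ)
    (hk : k ≤ n) :
    ∫⁻ x, ∏ i : Fin k, f (x (Fin.castLE hk i)) ∂(μ : Measure (Fin n → E)) ≤ C ^ k := by
  induction k with
  | zero => simp
  | succ k ih =>
    obtain ⟨κ, ⟨hκ, hmap⟩, hM⟩ := hμ ⟨k, hk⟩
    have hG : Measurable fun y : Fin k → E => ∏ i, f (y i) := by fun_prop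
    have hp : Measurable (past (E := E) (⟨k, hk⟩ : Fin n)) := measurable_past _
    calc ∫⁻ x, ∏ i : Fin (k + 1), f (x (Fin.castLE hk i)) ∂(μ : Measure (Fin n → E))
        = ∫⁻ x, (∏ i, f (past ⟨k, hk⟩ x i)) * f (x ⟨k, hk⟩) ∂(μ : Measure (Fin n → E)) := by
          refine lintegral_congr fun x => ?_
          rw [Fin.prod_univ_castSucc]
          rfl
      _ = ∫⁻ p : (Fin k → E) × E, (∏ i, f (p.1 i)) * f p.2
            ∂((μ : Measure (Fin n → E)).map fun x => (past ⟨k, hk⟩ x, x ⟨k, hk⟩)) := by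
          rw [lintegral_map (by fun_prop) (by fun_prop)]
      _ = ∫⁻ y, ∫⁻ z, (∏ i, f (y i)) * f z ∂κ y
            ∂((μ : Measure (Fin n → E)).map (past ⟨k, hk⟩)) := by
          rw [hmap, Measure.lintegral_compProd (by fun_prop)]
      _ = ∫⁻ y, (∏ i, f (y i)) * ∫⁻ z, f z ∂κ y
            ∂((μ : Measure (Fin n → E)).map (past ⟨k, hk⟩)) := by
          simp_rw [lintegral_const_mul _ hf]
      -- Return to `E^n`, where membership of the conditional law in `M` is known almost surely.
      _ = ∫⁻ x, (∏ i, f (past ⟨k, hk⟩ x i)) * ∫⁻ z, f z ∂κ (past ⟨k, hk⟩ x)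
            ∂(μ : Measure (Fin n → E)) := by
          exact lintegral_map (hG.mul hf.lintegral_kernel) hp
      _ ≤ ∫⁻ x, (∏ i, f (past ⟨k, hk⟩ x i)) * C ∂(μ : Measure (Fin n → E)) := by
          refine lintegral_mono_ae ?_
          filter_upwards [hM] with x hx
          obtain ⟨ν, hν, hνe⟩ := hx
          gcongr
          rw [← hνe]
          exact hC ν hν
      _ = (∫⁻ x, ∏ i, f (past ⟨k, hk⟩ x i) ∂(μ : Measure (Fin n → E))) * C :=
          lintegral_mul_const _ (hG.comp hp)
      _ ≤ C ^ k * C := by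
          gcongr
          exact ih (by omega)
      _ = C ^ (k + 1) := (pow_succ _ _).symm

/-- Chernoff's bound for the laws in `M_n`. -/
lemma measure_sum_ge_le {M : Set (ProbabilityMeasure E)} {n : ℕ}
    {μ : ProbabilityMeasure (Fin n → E)} (hμ : μ ∈ conditionalLaws M n) {f : E → ℝ}
    (hf : Measurable f) {C : ℝ≥0∞}
    (hC : ∀ ν ∈ M, ∫⁻ y, ENNReal.ofReal (Real.exp (f y)) ∂(ν : Measure E) ≤ C) (t : ℝ) :
    (μ : Measure (Fin n → E)) {x | t ≤ ∑ i, f (x i)} ≤ C ^ n * ENNReal.ofReal (Real.exp (-t)) := by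
  have h1 := lintegral_prod_le hμ (f := fun y => ENNReal.ofReal (Real.exp (f y)))
    (by fun_prop) hC n le_rfl
  have h2 := mul_meas_ge_le_lintegral (μ := (μ : Measure (Fin n → E)))
    (f := fun x => ∏ i : Fin n, ENNReal.ofReal (Real.exp (f (x (Fin.castLE le_rfl i)))))
    (by fun_prop) (ENNReal.ofReal (Real.exp t))
  have h3 : {x : Fin n → E | t ≤ ∑ i, f (x i)} ⊆ {x | ENNReal.ofReal (Real.exp t) ≤
      ∏ i : Fin n, ENNReal.ofReal (Real.exp (f (x (Fin.castLE le_rfl i))))} := by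
    intro x hx
    simp only [Set.mem_ofPred_eq] at hx ⊢
    rw [← ENNReal.ofReal_prod_of_nonneg fun i _ => (Real.exp_pos _).le, ← Real.exp_sum]
    exact ENNReal.ofReal_le_ofReal (Real.exp_le_exp.2 hx)
  have h4 := (mul_le_mul_right (measure_mono (μ := (μ : Measure (Fin n → E))) h3)
    (ENNReal.ofReal (Real.exp t))).trans (h2.trans h1)
  rw [Real.exp_neg, ENNReal.ofReal_inv_of_pos (Real.exp_pos _), ← div_eq_mul_inv,
    ENNReal.le_div_iff_mul_le (by simp [Real.exp_pos]) (by simp), mul_comm]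
  exact h4

end Empirical

/-! ### Local estimate, exponential tightness and the global upper bound -/

section UpperBound

variable {E : Type*} [TopologicalSpace E] [PolishSpace E] [MeasurableSpace E] [BorelSpace E]
  {M : Set (ProbabilityMeasure E)}

lemma ofReal_exp_mul_ofReal_exp (s t : ℝ) :
    ENNReal.ofReal (Real.exp s) * ENNReal.ofReal (Real.exp t)
      = ENNReal.ofReal (Real.exp (s + t)) := by
  rw [← ENNReal.ofReal_mul (Real.exp_pos _).le, Real.exp_add]

/-- Exponential estimate near a point `ν`. -/
lemma exists_isOpen_lintegral_le (hMne : M.Nonempty) (hMconv : IsConvex M) (hMcomp : IsCompact M)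
    (F : ProbabilityMeasure E →ᵇ ℝ) {ν : ProbabilityMeasure E} {b c : ℝ} (hcb : c < b)
    (h : ∀ μ ∈ M, ((F ν - c : ℝ) : EReal) < relEntropy ν μ) :
    ∃ U : Set (ProbabilityMeasure E), IsOpen U ∧ ν ∈ U ∧ ∀ (n : ℕ) [NeZero n],
      ∀ μ ∈ conditionalLaws M n,
      ∫⁻ x in {x | empiricalMeasure x ∈ U}, ENNReal.ofReal (Real.exp (n * F (empiricalMeasure x)))
        ∂(μ : Measure (Fin n → E)) ≤ ENNReal.ofReal (Real.exp (n * b)) := by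
  obtain ⟨f, hfν, hf⟩ := exists_testFunction hMne hMconv hMcomp h
  -- The margin `b - c` is split equally between the variation of `F` and that of `∫ f` on `U`.
  set δ := (b - c) / 2 with hδ
  have hδ0 : 0 < δ := by rw [hδ]; linarith
  have hfc : Continuous fun μ : ProbabilityMeasure E => ∫ x, f x ∂(μ : Measure E) :=
    ProbabilityMeasure.continuous_integral_boundedContinuousFunction f
  set U : Set (ProbabilityMeasure E) :=
    {ν' | F ν - c - δ < ∫ x, f x ∂(ν' : Measure E)} ∩ {ν' | F ν' < F ν + δ} with hU
  have hUo : IsOpen U := (isOpen_lt continuous_const hfc).inter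
    (isOpen_lt F.continuous continuous_const)
  refine ⟨U, hUo, ⟨?_, ?_⟩, fun n _ μ hμ => ?_⟩
  · rw [Set.mem_ofPred_eq, hfν]; linarith
  · rw [Set.mem_ofPred_eq]; linarith
  have hn : (0 : ℝ) < n := by exact_mod_cast Nat.pos_of_ne_zero (NeZero.ne n)
  have hm : MeasurableSet {x : Fin n → E | empiricalMeasure x ∈ U} :=
    (hUo.preimage continuous_empiricalMeasure).measurableSet
  have hμU : (μ : Measure (Fin n → E)) {x | empiricalMeasure x ∈ U}
      ≤ ENNReal.ofReal (Real.exp (-(n * (F ν - c - δ)))) := by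
    refine (measure_mono fun x hx => ?_).trans
      ((measure_sum_ge_le hμ f.continuous.measurable (C := 1) (fun μ' hμ' => ?_)
        (n * (F ν - c - δ))).trans (by simp))
    · have h1 : F ν - c - δ < ∫ y, f y ∂(empiricalMeasure x : Measure E) := hx.1
      rw [integral_empiricalMeasure x f.continuous.measurable, inv_mul_eq_div, lt_div_iff₀ hn] at h1
      rw [Set.mem_ofPred_eq]
      linarith
    · have h1 := ofReal_integral_eq_lintegral_ofReal ((expBCF f).integrable (μ' : Measure E))
        (Eventually.of_forall fun x => (Real.exp_pos _).le)
      simp only [expBCF_apply] at h1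
      rw [← h1]
      exact ENNReal.ofReal_le_one.2 (hf μ' hμ')
  calc _ ≤ ∫⁻ _ in {x | empiricalMeasure x ∈ U}, ENNReal.ofReal (Real.exp (n * (F ν + δ)))
          ∂(μ : Measure (Fin n → E)) := by
        refine setLIntegral_mono' hm fun x hx => ?_
        have h1 : F (empiricalMeasure x) < F ν + δ := hx.2
        gcongr
    _ = ENNReal.ofReal (Real.exp (n * (F ν + δ))) *
          (μ : Measure (Fin n → E)) {x | empiricalMeasure x ∈ U} := setLIntegral_const _ _
    _ ≤ _ := by
        refine (mul_le_mul_right hμU _).trans ?_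
        rw [ofReal_exp_mul_ofReal_exp]
        refine ENNReal.ofReal_le_ofReal (Real.exp_le_exp.2 (le_of_eq ?_))
        rw [hδ]; ring

/-- Exponential tightness of the empirical measures, uniformly over the laws in `M_n`. -/
lemma exists_isCompact_measure_compl_le (hMcomp : IsCompact M) {a : ℝ} (ha : 0 ≤ a) :
    ∃ K : Set (ProbabilityMeasure E), IsCompact K ∧ ∀ (n : ℕ) [NeZero n],
      ∀ μ ∈ conditionalLaws M n, (μ : Measure (Fin n → E)) {x | empiricalMeasure x ∉ K}
        ≤ 2 * ENNReal.ofReal (Real.exp (-(n * a))) := by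
  let _ := TopologicalSpace.upgradeIsCompletelyMetrizable E
  have htight := isTightMeasureSet_of_isCompact_closure (S := M)
    (by rwa [hMcomp.isClosed.closure_eq])
  rw [isTightMeasureSet_iff_exists_isCompact_measure_compl_le] at htight
  -- The factor `j + 1` offsets the mass threshold `1 / (j + 1)` defining the compact set. In `a + j
  -- + 1`, the `a` is the desired rate, `j` makes the union bound summable, and `1` absorbs the
  -- factor `2 ^ n`.
  set c : ℕ → ℝ := fun j => (j + 1) * (a + j + 1) with hc
  have hc0 : ∀ j, 0 ≤ c j := fun j => by rw [hc]; positivity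
  choose S hS hSM using fun j => htight (ENNReal.ofReal (Real.exp (-c j)))
    (by simp [Real.exp_pos])
  set u : ℕ → ℝ≥0 := fun j => 1 / ((j : ℝ≥0) + 1) with hu
  refine ⟨{ν | ∀ j, ν (S j)ᶜ ≤ u j}, isCompact_setOfPred_probabilityMeasure_mass_eq_compl_isCompact_le
    tendsto_one_div_add_atTop_nhds_zero_nat hS (Or.inl inferInstance), fun n _ μ hμ => ?_⟩
  have hn : (0 : ℝ) < n := by exact_mod_cast Nat.pos_of_ne_zero (NeZero.ne n)
  have hSm : ∀ j, MeasurableSet (S j)ᶜ := fun j => (hS j).isClosed.measurableSet.compl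
  have hbound : ∀ j, (μ : Measure (Fin n → E)) {x | u j < empiricalMeasure x (S j)ᶜ}
      ≤ ENNReal.ofReal (Real.exp (-(n * a))) * 2⁻¹ ^ j := by
    intro j
    have hfm : Measurable ((S j)ᶜ.indicator fun _ => c j) := measurable_const.indicator (hSm j)
    calc _ ≤ (μ : Measure (Fin n → E))
          {x | n * (a + j + 1) ≤ ∑ i, (S j)ᶜ.indicator (fun _ => c j) (x i)} := by
          refine measure_mono fun x hx => ?_
          have h1 : (u j : ℝ) < (empiricalMeasure x : Measure E).real (S j)ᶜ := by
            exact_mod_cast hx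
          have h2 := integral_empiricalMeasure x hfm
          rw [integral_indicator_const _ (hSm j), smul_eq_mul, inv_mul_eq_div,
            eq_div_iff hn.ne'] at h2
          rw [Set.mem_ofPred_eq, ← h2]
          have h3 : (a + j + 1) ≤ (empiricalMeasure x : Measure E).real (S j)ᶜ * c j := by
            calc a + j + 1 = (u j : ℝ) * c j := by simp [hu, hc]; field_simp
              _ ≤ _ := by gcongr
          nlinarith
      _ ≤ 2 ^ n * ENNReal.ofReal (Real.exp (-(n * (a + j + 1)))) := by
          refine measure_sum_ge_le hμ hfm (fun ν hν => ?_) _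
          calc _ ≤ ∫⁻ y, (1 + (S j)ᶜ.indicator (fun _ => ENNReal.ofReal (Real.exp (c j))) y)
                ∂(ν : Measure E) := by
                refine lintegral_mono fun y => ?_
                by_cases hy : y ∈ (S j)ᶜ <;> simp [hy]
            _ = 1 + ENNReal.ofReal (Real.exp (c j)) * (ν : Measure E) (S j)ᶜ := by
                rw [lintegral_add_left measurable_const, lintegral_indicator_const (hSm j)]
                simp
            _ ≤ 1 + ENNReal.ofReal (Real.exp (c j)) * ENNReal.ofReal (Real.exp (-c j)) := by
                gcongr
                exact hSM j _ ⟨ν, hν, rfl⟩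
            _ = 2 := by
                rw [ofReal_exp_mul_ofReal_exp]; simp; norm_num
      _ ≤ ENNReal.ofReal (Real.exp n) * ENNReal.ofReal (Real.exp (-(n * (a + j + 1)))) := by
          gcongr
          rw [← mul_one (n : ℝ), Real.exp_nat_mul, ENNReal.ofReal_pow (Real.exp_pos _).le]
          gcongr
          rw [← ENNReal.ofReal_ofNat]
          exact ENNReal.ofReal_le_ofReal (by linarith [Real.add_one_le_exp 1])
      _ = ENNReal.ofReal (Real.exp (-(n * a))) * ENNReal.ofReal (Real.exp (-(n * j))) := by
          rw [ofReal_exp_mul_ofReal_exp, ofReal_exp_mul_ofReal_exp]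
          congr 2; ring
      _ ≤ _ := by
          gcongr
          calc ENNReal.ofReal (Real.exp (-(n * j))) ≤ ENNReal.ofReal ((2⁻¹ : ℝ) ^ j) := by
                refine ENNReal.ofReal_le_ofReal ?_
                have h1 : (1 : ℝ) ≤ n := by exact_mod_cast Nat.pos_of_ne_zero (NeZero.ne n)
                calc Real.exp (-(n * j)) ≤ Real.exp (j * (-1)) := by
                      gcongr; nlinarith [j.cast_nonneg (α := ℝ)]
                  _ = Real.exp (-1) ^ j := Real.exp_nat_mul _ _
                  _ ≤ _ := by
                      gcongr
                      rw [Real.exp_neg]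
                      gcongr
                      linarith [Real.add_one_le_exp 1]
            _ = _ := by
                rw [ENNReal.ofReal_pow (by norm_num), ENNReal.ofReal_inv_of_pos (by norm_num)]
                simp
  calc _ ≤ (μ : Measure (Fin n → E)) (⋃ j, {x | u j < empiricalMeasure x (S j)ᶜ}) := by
        refine measure_mono fun x hx => ?_
        simpa using hx
    _ ≤ ∑' j, ENNReal.ofReal (Real.exp (-(n * a))) * 2⁻¹ ^ j :=
        (measure_iUnion_le _).trans (ENNReal.tsum_le_tsum hbound)
    _ = _ := by
        rw [ENNReal.tsum_mul_left, ENNReal.tsum_geometric, ENNReal.one_sub_inv_two, inv_inv,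
          mul_comm]

/-- Upper bound of Laplace-Varadhan type, uniform over the laws in `M_n`, on a closed set. -/
lemma exists_lintegral_le (hMne : M.Nonempty) (hMconv : IsConvex M) (hMcomp : IsCompact M)
    (F : ProbabilityMeasure E →ᵇ ℝ) {A : Set (ProbabilityMeasure E)} (hA : IsClosed A) {b c : ℝ}
    (hcb : c < b) (h : ∀ ν ∈ A, ∀ μ ∈ M, ((F ν - c : ℝ) : EReal) < relEntropy ν μ) :
    ∃ C : ℝ≥0, 0 < C ∧ ∀ (n : ℕ) [NeZero n], ∀ μ ∈ conditionalLaws M n,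
      ∫⁻ x in {x | empiricalMeasure x ∈ A}, ENNReal.ofReal (Real.exp (n * F (empiricalMeasure x)))
        ∂(μ : Measure (Fin n → E)) ≤ C * ENNReal.ofReal (Real.exp (n * b)) := by
  -- Off `K` this rate beats `exp (n * ‖F‖)` and leaves at most `2 * exp (n * b)`, whatever the sign
  -- of `b`.
  obtain ⟨K, hK, hKb⟩ := exists_isCompact_measure_compl_le hMcomp (a := ‖F‖ + |b|) (by positivity)
  choose! U hUo hνU hU using fun ν (hν : ν ∈ A) =>
    exists_isOpen_lintegral_le hMne hMconv hMcomp F hcb (h ν hν)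
  obtain ⟨t, ht⟩ := (hK.inter_left hA).elim_nhds_subcover' (fun ν _ => U ν)
    fun ν hν => (hUo ν hν.1).mem_nhds (hνU ν hν.1)
  refine ⟨t.card + 2, by positivity, fun n _ μ hμ => ?_⟩
  set g : (Fin n → E) → ℝ≥0∞ := fun x => ENNReal.ofReal (Real.exp (n * F (empiricalMeasure x)))
  have hKm : MeasurableSet {x : Fin n → E | empiricalMeasure x ∉ K} :=
    (hK.isClosed.isOpen_compl.preimage continuous_empiricalMeasure).measurableSet
  have hsub : {x : Fin n → E | empiricalMeasure x ∈ A} ⊆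
      (⋃ ν : t, {x | empiricalMeasure x ∈ U ν.1.1}) ∪ {x | empiricalMeasure x ∉ K} := by
    intro x hx
    by_cases hxK : empiricalMeasure x ∈ K
    · obtain ⟨ν, hν, hxν⟩ := Set.mem_iUnion₂.1 (ht ⟨hx, hxK⟩)
      exact Or.inl (Set.mem_iUnion.2 ⟨⟨ν, hν⟩, hxν⟩)
    · exact Or.inr hxK
  have h1 : ∫⁻ x in ⋃ ν : t, {x | empiricalMeasure x ∈ U ν.1.1}, g x ∂(μ : Measure (Fin n → E))
      ≤ t.card * ENNReal.ofReal (Real.exp (n * b)) := by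
    refine (lintegral_iUnion_le _ _).trans ?_
    rw [tsum_fintype, ← nsmul_eq_mul]
    refine (Finset.sum_le_card_nsmul _ _ _ fun ν _ => hU ν.1.1 ν.1.2.1 n μ hμ).trans ?_
    simp
  have h2 : ∫⁻ x in {x | empiricalMeasure x ∉ K}, g x ∂(μ : Measure (Fin n → E))
      ≤ 2 * ENNReal.ofReal (Real.exp (n * b)) := by
    calc _ ≤ ∫⁻ _ in {x | empiricalMeasure x ∉ K}, ENNReal.ofReal (Real.exp (n * ‖F‖))
            ∂(μ : Measure (Fin n → E)) := by
          refine setLIntegral_mono' hKm fun x _ => ?_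
          refine ENNReal.ofReal_le_ofReal (Real.exp_le_exp.2 ?_)
          gcongr
          exact (le_abs_self _).trans (F.norm_coe_le_norm _)
      _ = ENNReal.ofReal (Real.exp (n * ‖F‖)) *
            (μ : Measure (Fin n → E)) {x | empiricalMeasure x ∉ K} := setLIntegral_const _ _
      _ ≤ ENNReal.ofReal (Real.exp (n * ‖F‖)) *
            (2 * ENNReal.ofReal (Real.exp (-(n * (‖F‖ + |b|))))) := by
          gcongr
          exact hKb n μ hμ
      _ = 2 * ENNReal.ofReal (Real.exp (n * -|b|)) := by
          rw [mul_left_comm, ofReal_exp_mul_ofReal_exp]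
          congr 3; ring
      _ ≤ _ := by
          gcongr
          exact neg_abs_le b
  calc _ ≤ ∫⁻ x in (⋃ ν : t, {x | empiricalMeasure x ∈ U ν.1.1}) ∪ {x | empiricalMeasure x ∉ K},
          g x ∂(μ : Measure (Fin n → E)) := lintegral_mono_set hsub
    _ ≤ _ := lintegral_union_le _ _ _
    _ ≤ _ := add_le_add h1 h2
    _ = _ := by push_cast; ring

end UpperBound

/-! ### Independent samples: change of measure and law of large numbers -/

section IID

variable {E : Type*} [MeasurableSpace E]

/-- The law of `n` independent variables with law `ν`. -/
def iidLaw (ν : ProbabilityMeasure E) (n : ℕ) : ProbabilityMeasure (Fin n → E) :=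
  ⟨Measure.pi fun _ => (ν : Measure E), inferInstance⟩

lemma toMeasure_iidLaw (ν : ProbabilityMeasure E) (n : ℕ) :
    (iidLaw ν n : Measure (Fin n → E)) = Measure.pi fun _ => (ν : Measure E) := rfl

lemma iidLaw_mem_conditionalLaws {M : Set (ProbabilityMeasure E)} {ν : ProbabilityMeasure E}
    (hν : ν ∈ M) (n : ℕ) : iidLaw ν n ∈ conditionalLaws M n := by
  intro k
  refine ⟨Kernel.const _ (ν : Measure E), ⟨inferInstance, ?_⟩,
    Eventually.of_forall fun x => ⟨ν, hν, by simp⟩⟩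
  have hind : iIndepFun (fun (i : Fin n) (x : Fin n → E) => x i)
      (Measure.pi fun _ => (ν : Measure E)) :=
    iIndepFun_pi (X := fun _ => id) fun _ => aemeasurable_id
  have h1 := hind.indepFun_finset (Finset.univ.filter (· < k)) {k} (by simp)
    fun i => measurable_pi_apply i
  have hφ : Measurable fun (y : Finset.univ.filter (· < k) → E) (i : Fin k) =>
      y ⟨Fin.castLE k.isLt.le i, Finset.mem_filter.2 ⟨Finset.mem_univ _, i.isLt⟩⟩ :=
    measurable_pi_lambda _ fun i => measurable_pi_apply _
  have hψ : Measurable fun y : ({k} : Finset (Fin n)) → E => y ⟨k, Finset.mem_singleton_self k⟩ :=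
    measurable_pi_apply _
  have h2 : IndepFun (past k) (fun x : Fin n → E => x k)
      (Measure.pi fun _ => (ν : Measure E)) := h1.comp hφ hψ
  rw [toMeasure_iidLaw, Measure.compProd_const, (indepFun_iff_map_prod_eq_prod_map_map
    (measurable_past k).aemeasurable (measurable_pi_apply k).aemeasurable).1 h2]
  congr 1
  exact (measurePreserving_eval (fun _ : Fin n => (ν : Measure E)) k).map_eq

/-- It suffices to compare rectangles, on which the integral of the density factorises by
independence under `μ^n`. -/
lemma pi_eq_withDensity {n : ℕ} {ν μ : Measure E} [IsProbabilityMeasure ν]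
    [IsProbabilityMeasure μ] (hac : ν ≪ μ) :
    (Measure.pi fun _ : Fin n => ν)
      = (Measure.pi fun _ : Fin n => μ).withDensity fun x => ∏ i, ν.rnDeriv μ (x i) := by
  refine Measure.pi_eq fun s hs => ?_
  have hm : ∀ i, Measurable ((s i).indicator (ν.rnDeriv μ)) := fun i =>
    (Measure.measurable_rnDeriv _ _).indicator (hs i)
  have hind : iIndepFun (fun (i : Fin n) (x : Fin n → E) => (s i).indicator (ν.rnDeriv μ) (x i))
      (Measure.pi fun _ => μ) :=
    iIndepFun_pi (X := fun i => (s i).indicator (ν.rnDeriv μ)) fun i => (hm i).aemeasurable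
  rw [withDensity_apply _ (MeasurableSet.univ_pi hs),
    ← lintegral_indicator (MeasurableSet.univ_pi hs)]
  calc _ = ∫⁻ x : Fin n → E, ∏ i, (s i).indicator (ν.rnDeriv μ) (x i) ∂(Measure.pi fun _ => μ) := by
        refine lintegral_congr fun x => ?_
        by_cases hx : x ∈ Set.univ.pi s
        · rw [Set.indicator_of_mem hx]
          exact Finset.prod_congr rfl fun i _ => by
            rw [Set.indicator_of_mem (hx i (Set.mem_univ i))]
        · rw [Set.indicator_of_notMem hx]
          obtain ⟨i, hi⟩ : ∃ i, x i ∉ s i := by simpa [Set.mem_univ_pi] using hx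
          exact (Finset.prod_eq_zero (Finset.mem_univ i) (Set.indicator_of_notMem hi _)).symm
    _ = ∏ i, ∫⁻ x : Fin n → E, (s i).indicator (ν.rnDeriv μ) (x i) ∂(Measure.pi fun _ => μ) :=
        lintegral_prod_eq_prod_lintegral_of_indepFun _ _ hind
          fun i => (hm i).comp (measurable_pi_apply i)
    _ = ∏ i, ν (s i) := by
        refine Finset.prod_congr rfl fun i _ => ?_
        rw [(measurePreserving_eval (fun _ : Fin n => μ) i).lintegral_comp (hm i),
          lintegral_indicator (hs i), Measure.setLIntegral_rnDeriv hac]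

/-- Jensen's inequality for the exponential, without integrability of the exponential. -/
lemma ofReal_exp_integral_le_lintegral {α : Type*} [MeasurableSpace α] {P : Measure α}
    [IsProbabilityMeasure P] {h : α → ℝ} (hh : Integrable h P) :
    ENNReal.ofReal (Real.exp (∫ x, h x ∂P)) ≤ ∫⁻ x, ENNReal.ofReal (Real.exp (h x)) ∂P := by
  set c := ∫ x, h x ∂P with hc
  -- The tangent line of `exp` at the mean `c` is integrable even when `exp ∘ h` is not.
  have hi : Integrable (fun x => Real.exp c * (h x + (1 - c))) P :=
    (hh.add (integrable_const _)).const_mul _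
  have h1 : ∫ x, Real.exp c * (h x + (1 - c)) ∂P = Real.exp c := by
    rw [integral_const_mul, integral_add hh (integrable_const _)]
    simp [← hc]
  calc _ = ENNReal.ofReal (∫ x, Real.exp c * (h x + (1 - c)) ∂P) := by rw [h1]
    _ ≤ ∫⁻ x, ENNReal.ofReal (Real.exp c * (h x + (1 - c))) ∂P := by
        refine ENNReal.ofReal_le_of_le_toReal ?_
        rw [integral_eq_lintegral_pos_part_sub_lintegral_neg_part hi]
        exact sub_le_self _ ENNReal.toReal_nonneg
    _ ≤ _ := by
        refine lintegral_mono fun x => ENNReal.ofReal_le_ofReal ?_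
        calc _ ≤ Real.exp c * Real.exp (h x - c) := by
              gcongr; linarith [Real.add_one_le_exp (h x - c)]
          _ = _ := by rw [← Real.exp_add]; ring_nf

/-- Gibbs' variational inequality for product measures. -/
lemma ofReal_exp_le_lintegral_pi {n : ℕ} {ν μ : Measure E} [IsProbabilityMeasure ν]
    [IsProbabilityMeasure μ] (hac : ν ≪ μ) (hint : Integrable (llr ν μ) ν) {g : (Fin n → E) → ℝ}
    (hg : Measurable g) (hgi : Integrable g (Measure.pi fun _ => ν)) :
    ENNReal.ofReal (Real.exp (∫ x, g x ∂(Measure.pi fun _ => ν) - n * ∫ y, llr ν μ y ∂ν))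
      ≤ ∫⁻ x, ENNReal.ofReal (Real.exp (g x)) ∂(Measure.pi fun _ => μ) := by
  set r : (Fin n → E) → ℝ≥0∞ := fun x => ∏ i, ν.rnDeriv μ (x i) with hr
  have hrm : Measurable r := by
    have := Measure.measurable_rnDeriv ν μ
    fun_prop
  have hsum : Integrable (fun x : Fin n → E => ∑ i, llr ν μ (x i)) (Measure.pi fun _ => ν) :=
    integrable_finsetSum _ fun i _ => integrable_comp_eval hint
  have hI : ∫ x, (g x - ∑ i, llr ν μ (x i)) ∂(Measure.pi fun _ => ν)
      = ∫ x, g x ∂(Measure.pi fun _ => ν) - n * ∫ y, llr ν μ y ∂ν := by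
    rw [integral_sub hgi hsum, integral_finsetSum _ fun i _ => integrable_comp_eval hint]
    simp_rw [integral_comp_eval (μ := fun _ : Fin n => ν) hint.aestronglyMeasurable]
    simp
  have hae : ∀ᵐ x ∂(Measure.pi fun _ : Fin n => ν),
      ∀ i, 0 < ν.rnDeriv μ (x i) ∧ ν.rnDeriv μ (x i) < ∞ := by
    refine ae_all_iff.2 fun i => ?_
    have h1 : ∀ᵐ y ∂ν, 0 < ν.rnDeriv μ y ∧ ν.rnDeriv μ y < ∞ :=
      (Measure.rnDeriv_pos hac).and (hac.ae_le (Measure.rnDeriv_lt_top ν μ))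
    exact (measurePreserving_eval (fun _ : Fin n => ν) i).quasiMeasurePreserving.ae h1
  rw [← hI]
  calc _ ≤ ∫⁻ x, ENNReal.ofReal (Real.exp (g x - ∑ i, llr ν μ (x i)))
          ∂(Measure.pi fun _ => ν) := ofReal_exp_integral_le_lintegral (hgi.sub hsum)
    _ = ∫⁻ x, ENNReal.ofReal (Real.exp (g x)) * (r x)⁻¹ ∂(Measure.pi fun _ => ν) := by
        refine lintegral_congr_ae ?_
        filter_upwards [hae] with x hx
        have hpos : ∀ i, 0 < (ν.rnDeriv μ (x i)).toReal := fun i =>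
          ENNReal.toReal_pos (hx i).1.ne' (hx i).2.ne
        have h1 : Real.exp (∑ i, llr ν μ (x i)) = (r x).toReal := by
          rw [Real.exp_sum, hr, ENNReal.toReal_prod]
          exact Finset.prod_congr rfl fun i _ => Real.exp_log (hpos i)
        have h2 : r x ≠ ∞ := ENNReal.prod_ne_top fun i _ => (hx i).2.ne
        rw [Real.exp_sub, ENNReal.ofReal_div_of_pos (Real.exp_pos _), h1,
          ENNReal.ofReal_toReal h2, div_eq_mul_inv]
    _ = ∫⁻ x, r x * (ENNReal.ofReal (Real.exp (g x)) * (r x)⁻¹) ∂(Measure.pi fun _ => μ) := by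
        rw [pi_eq_withDensity hac, lintegral_withDensity_eq_lintegral_mul _ hrm (by fun_prop)]
        rfl
    -- Only an inequality: `r * r⁻¹` is `0` where the density vanishes.
    _ ≤ _ := by
        refine lintegral_mono fun x => ?_
        calc _ = ENNReal.ofReal (Real.exp (g x)) * (r x * (r x)⁻¹) := by ring
          _ ≤ ENNReal.ofReal (Real.exp (g x)) * 1 := by gcongr; exact ENNReal.mul_inv_le_one _
          _ = _ := mul_one _

/-- Chebyshev's inequality: the variance of a sum of `n + 1` independent terms is `n + 1` times that
of one term. -/
lemma tendsto_measure_integral_empiricalMeasure {ν : ProbabilityMeasure E} {f : E → ℝ}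
    (hf : Measurable f) {B : ℝ} (hB : ∀ x, |f x| ≤ B) {ε : ℝ} (hε : 0 < ε) :
    Tendsto (fun n : ℕ => (iidLaw ν (n + 1) : Measure (Fin (n + 1) → E))
      {x | ε ≤ |∫ y, f y ∂(empiricalMeasure x : Measure E) - ∫ y, f y ∂(ν : Measure E)|})
      atTop (𝓝 0) := by
  have hL : MemLp f 2 (ν : Measure E) :=
    MemLp.of_bound hf.aestronglyMeasurable B (Eventually.of_forall hB)
  set V := Var[f; (ν : Measure E)] with hV
  have hlim : Tendsto (fun n : ℕ => ENNReal.ofReal ((V / ε ^ 2) * (1 / ((n : ℝ) + 1))))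
      atTop (𝓝 0) := by
    have := (tendsto_one_div_add_atTop_nhds_zero_nat (𝕜 := ℝ)).const_mul (V / ε ^ 2)
    rw [mul_zero] at this
    simpa using ENNReal.tendsto_ofReal this
  refine tendsto_of_tendsto_of_tendsto_of_le_of_le tendsto_const_nhds hlim
    (fun _ => zero_le) fun n => ?_
  have hn : (0 : ℝ) < (n + 1 : ℕ) := by positivity
  have hLs : MemLp (∑ i : Fin (n + 1), fun x : Fin (n + 1) → E => f (x i)) 2
      (Measure.pi fun _ => (ν : Measure E)) :=
    memLp_finsetSum' _ fun i _ =>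
      hL.comp_measurePreserving (measurePreserving_eval (fun _ => (ν : Measure E)) i)
  have hvar := variance_sum_pi (μ := fun _ : Fin (n + 1) => (ν : Measure E)) (X := fun _ => f)
    fun _ => hL
  have hmean : ∫ x, (∑ i : Fin (n + 1), fun x : Fin (n + 1) → E => f (x i)) x
      ∂(Measure.pi fun _ => (ν : Measure E)) = (n + 1 : ℕ) * ∫ y, f y ∂(ν : Measure E) := by
    simp only [Finset.sum_apply]
    have hfi : Integrable f (ν : Measure E) := integrable_of_abs_le hf hB
    rw [integral_finsetSum _ fun i _ => integrable_comp_eval hfi]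
    simp_rw [integral_comp_eval (μ := fun _ : Fin (n + 1) => (ν : Measure E))
      hfi.aestronglyMeasurable]
    simp
  have hcheb := meas_ge_le_variance_div_sq hLs (mul_pos hn hε)
  rw [hvar, hmean] at hcheb
  refine (measure_mono fun x hx => ?_).trans (hcheb.trans (le_of_eq ?_))
  · simp only [Set.mem_ofPred_eq, Finset.sum_apply] at hx ⊢
    rw [integral_empiricalMeasure x hf] at hx
    calc _ ≤ ((n + 1 : ℕ) : ℝ) *
          |((n + 1 : ℕ) : ℝ)⁻¹ * ∑ i, f (x i) - ∫ y, f y ∂(ν : Measure E)| := by gcongr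
      _ = _ := by
          rw [← abs_of_pos hn, ← abs_mul, abs_of_pos hn, mul_sub, mul_inv_cancel_left₀ hn.ne']
  · congr 1
    simp only [Finset.sum_const, Finset.card_univ, Fintype.card_fin, nsmul_eq_mul, ← hV]
    push_cast
    have : (n : ℝ) + 1 ≠ 0 := by positivity
    field_simp

variable [TopologicalSpace E] [BorelSpace E]

/-- The weak law of large numbers for empirical measures, in the weak topology. -/
lemma tendsto_measure_empiricalMeasure_notMem {ν : ProbabilityMeasure E}
    {U : Set (ProbabilityMeasure E)} (hU : U ∈ 𝓝 ν) :
    Tendsto (fun n : ℕ => (iidLaw ν (n + 1) : Measure (Fin (n + 1) → E))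
      {x | empiricalMeasure x ∉ U}) atTop (𝓝 0) := by
  -- The sets that capture `L_n` with probability tending to `1` form a filter. Convergence of this
  -- filter to `ν` can be tested on one bounded continuous function at a time, which reduces weak
  -- neighbourhoods to the scalar law of large numbers.
  let G : Filter (ProbabilityMeasure E) :=
    { sets := {U | Tendsto (fun n : ℕ => (iidLaw ν (n + 1) : Measure (Fin (n + 1) → E))
        {x | empiricalMeasure x ∉ U}) atTop (𝓝 0)}
      univ_sets := by simp
      sets_of_superset := fun {U V} hU hUV =>
        tendsto_of_tendsto_of_tendsto_of_le_of_le tendsto_const_nhds hU (fun _ => zero_le)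
          fun n => measure_mono fun x hx hxU => hx (hUV hxU)
      inter_sets := fun {U V} hU hV => by
        rw [Set.mem_ofPred_eq] at hU hV ⊢
        have h := hU.add hV
        rw [add_zero] at h
        refine tendsto_of_tendsto_of_tendsto_of_le_of_le tendsto_const_nhds h (fun _ => zero_le)
          fun n => (measure_mono fun x hx => ?_).trans (measure_union_le _ _)
        by_cases hxU : empiricalMeasure x ∈ U
        · exact Or.inr fun hxV => hx ⟨hxU, hxV⟩
        · exact Or.inl hxU }
  suffices h : Tendsto id G (𝓝 ν) from h hU
  rw [ProbabilityMeasure.tendsto_iff_forall_integral_tendsto]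
  intro f
  rw [Metric.tendsto_nhds]
  intro ε hε
  change Tendsto _ _ _
  refine (tendsto_measure_integral_empiricalMeasure (ν := ν) f.continuous.measurable
    (fun x => f.norm_coe_le_norm x) hε).congr fun n => ?_
  congr 1
  ext x
  simp [Real.dist_eq]

variable [PolishSpace E]

/-- By continuity `F ∘ L_n` is within `ε / 2` of `F ν` off an event of vanishing probability, on
which the error is at most `2 * ‖F‖`. -/
lemma tendsto_integral_comp_empiricalMeasure (ν : ProbabilityMeasure E)
    (F : ProbabilityMeasure E →ᵇ ℝ) :
    Tendsto (fun n : ℕ => ∫ x, F (empiricalMeasure x)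
      ∂(iidLaw ν (n + 1) : Measure (Fin (n + 1) → E))) atTop (𝓝 (F ν)) := by
  rw [Metric.tendsto_atTop']
  intro ε hε
  have hU : {ν' | |F ν' - F ν| < ε / 2} ∈ 𝓝 ν := by
    have := F.continuous.tendsto ν (Metric.ball_mem_nhds _ (half_pos hε))
    simpa [Metric.ball, Real.dist_eq] using this
  have h1 := tendsto_measure_empiricalMeasure_notMem hU
  have h2 := ((ENNReal.tendsto_toReal ENNReal.zero_ne_top).comp h1).const_mul (2 * ‖F‖)
  rw [ENNReal.toReal_zero, mul_zero] at h2
  obtain ⟨N, hN⟩ := eventually_atTop.1 (h2.eventually_lt_const (half_pos hε))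
  refine ⟨N, fun n hn => ?_⟩
  set P : Measure (Fin (n + 1) → E) := (iidLaw ν (n + 1) : Measure (Fin (n + 1) → E)) with hP
  set S : Set (Fin (n + 1) → E) := {x | empiricalMeasure x ∉ {ν' | |F ν' - F ν| < ε / 2}} with hS
  have hcont : Continuous fun x : Fin (n + 1) → E => F (empiricalMeasure x) :=
    F.continuous.comp continuous_empiricalMeasure
  have hSm : MeasurableSet S := by
    have : IsClosed S := by
      have h3 : S = {x | ε / 2 ≤ |F (empiricalMeasure x) - F ν|} := by
        ext x; simp [hS]
      rw [h3]
      exact isClosed_le continuous_const (hcont.sub continuous_const).abs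
    exact this.measurableSet
  have hi : Integrable (fun x => F (empiricalMeasure x)) P :=
    integrable_of_abs_le hcont.measurable fun x => F.norm_coe_le_norm _
  have h3 : ∫ x, F (empiricalMeasure x) ∂P - F ν = ∫ x, (F (empiricalMeasure x) - F ν) ∂P := by
    rw [integral_sub hi (integrable_const _)]; simp
  rw [Real.dist_eq, h3]
  calc _ ≤ ∫ x, |F (empiricalMeasure x) - F ν| ∂P := abs_integral_le_integral_abs
    _ ≤ ∫ x, (ε / 2 + S.indicator (fun _ => 2 * ‖F‖) x) ∂P := by
        refine integral_mono (hi.sub (integrable_const _)).abs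
          ((integrable_const _).add ((integrable_const _).indicator hSm)) fun x => ?_
        by_cases hx : x ∈ S
        · have h4 := abs_le.1 (F.norm_coe_le_norm (empiricalMeasure x))
          have h5 := abs_le.1 (F.norm_coe_le_norm ν)
          simp only [Set.indicator_of_mem hx]
          have : |F (empiricalMeasure x) - F ν| ≤ 2 * ‖F‖ := abs_le.2 ⟨by linarith, by linarith⟩
          linarith
        · simp only [Set.indicator_of_notMem hx, add_zero]
          simp only [hS, Set.mem_ofPred_eq, not_not] at hx
          exact hx.le
    _ = ε / 2 + 2 * ‖F‖ * P.real S := by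
        rw [integral_add (integrable_const _) ((integrable_const _).indicator hSm),
          integral_indicator_const _ hSm]
        simp [mul_comm]
    _ < ε := by
        have h4 : 2 * ‖F‖ * P.real S < ε / 2 := hN n hn.le
        linarith

open InformationTheory in
/-- Lower bound for the exponential functionals of an i.i.d. law. -/
lemma le_log_lintegral_iidLaw (F : ProbabilityMeasure E →ᵇ ℝ) {ν μ : ProbabilityMeasure E}
    (h : klDiv (ν : Measure E) (μ : Measure E) ≠ ∞) (n : ℕ) [NeZero n] :
    ((∫ x, F (empiricalMeasure x) ∂(iidLaw ν n : Measure (Fin n → E))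
        - (klDiv (ν : Measure E) (μ : Measure E)).toReal : ℝ) : EReal)
      ≤ ENNReal.log (∫⁻ x, ENNReal.ofReal (Real.exp (n * F (empiricalMeasure x)))
        ∂(iidLaw μ n : Measure (Fin n → E))) / (n : EReal) := by
  obtain ⟨hac, hint⟩ := klDiv_ne_top_iff.1 h
  have hn : 0 < n := Nat.pos_of_ne_zero (NeZero.ne n)
  have hcont : Continuous fun x : Fin n → E => F (empiricalMeasure x) :=
    F.continuous.comp continuous_empiricalMeasure
  have hi : Integrable (fun x : Fin n → E => F (empiricalMeasure x))
      (Measure.pi fun _ => (ν : Measure E)) :=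
    integrable_of_abs_le hcont.measurable fun x => F.norm_coe_le_norm _
  have h1 := ofReal_exp_le_lintegral_pi hac hint (hcont.measurable.const_mul (n : ℝ))
    (hi.const_mul _)
  have h2 := ENNReal.log_monotone h1
  rw [ENNReal.log_ofReal_of_pos (Real.exp_pos _), Real.log_exp, integral_const_mul, ← mul_sub,
    ← toReal_klDiv_of_measure_eq hac (by simp)] at h2
  rw [EReal.le_div_iff_mul_le (by exact_mod_cast hn) (EReal.natCast_ne_top n)]
  refine le_trans (le_of_eq ?_) h2
  rw [mul_comm]
  push_cast
  rfl

end IID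

/-! ### Passage to the limit -/

section Limits

variable {E : Type*} [TopologicalSpace E] [PolishSpace E] [MeasurableSpace E] [BorelSpace E]
  {M : Set (ProbabilityMeasure E)}

/-- The constant `C` of `exists_lintegral_le` contributes only `log C / (n + 1)`, which vanishes. -/
lemma limsup_le_of_lt_relEntropy (hMne : M.Nonempty) (hMconv : IsConvex M) (hMcomp : IsCompact M)
    (F : ProbabilityMeasure E →ᵇ ℝ) {A : Set (ProbabilityMeasure E)} (hA : IsClosed A) {b c : ℝ}
    (hcb : c < b) (h : ∀ ν ∈ A, ∀ μ ∈ M, ((F ν - c : ℝ) : EReal) < relEntropy ν μ) :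
    limsup (fun n : ℕ => ⨆ μ ∈ conditionalLaws M (n + 1),
      ENNReal.log (∫⁻ x in {x | empiricalMeasure x ∈ A}, ENNReal.ofReal
        (Real.exp (((n + 1 : ℕ) : ℝ) * F (empiricalMeasure x)))
          ∂(μ : Measure (Fin (n + 1) → E))) / ((n + 1 : ℕ) : EReal)) atTop ≤ (b : EReal) := by
  obtain ⟨C, hC, hbound⟩ := exists_lintegral_le hMne hMconv hMcomp F hA hcb h
  have hlim : Tendsto (fun n : ℕ => ((Real.log C * (1 / ((n : ℝ) + 1)) + b : ℝ) : EReal)) atTop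
      (𝓝 (b : EReal)) := by
    have := ((tendsto_one_div_add_atTop_nhds_zero_nat (𝕜 := ℝ)).const_mul
      (Real.log C)).add_const b
    rw [mul_zero, zero_add] at this
    exact (continuous_coe_real_ereal.tendsto b).comp this
  rw [← hlim.limsup_eq]
  refine limsup_le_limsup (Eventually.of_forall fun n => iSup₂_le fun μ hμ => ?_)
  rw [EReal.div_le_iff_le_mul (by exact_mod_cast n.succ_pos) (EReal.natCast_ne_top _)]
  refine (ENNReal.log_monotone (hbound (n + 1) μ hμ)).trans (le_of_eq ?_)
  rw [← ENNReal.ofReal_coe_nnreal, ← ENNReal.ofReal_mul (by positivity),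
    ENNReal.log_ofReal_of_pos (mul_pos (by exact_mod_cast hC) (Real.exp_pos _)),
    Real.log_mul (by exact_mod_cast hC.ne') (Real.exp_pos _).ne', Real.log_exp,
    ← EReal.coe_coe_eq_natCast, ← EReal.coe_mul]
  congr 1
  push_cast
  field_simp

/-- The i.i.d. law of `μ` competes in the supremum over `M_n`; if the entropy is infinite, the left
side is `⊥`. -/
lemma le_liminf (F : ProbabilityMeasure E →ᵇ ℝ) {ν μ : ProbabilityMeasure E} (hμ : μ ∈ M) :
    ((F ν : ℝ) : EReal) - relEntropy ν μ ≤
      liminf (fun n : ℕ => ⨆ μ ∈ conditionalLaws M (n + 1),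
        ENNReal.log (∫⁻ x, ENNReal.ofReal
          (Real.exp (((n + 1 : ℕ) : ℝ) * F (empiricalMeasure x)))
            ∂(μ : Measure (Fin (n + 1) → E))) / ((n + 1 : ℕ) : EReal)) atTop := by
  by_cases h : InformationTheory.klDiv (ν : Measure E) (μ : Measure E) = ∞
  · simp [relEntropy, h]
  have hrel : relEntropy ν μ
      = ((InformationTheory.klDiv (ν : Measure E) (μ : Measure E)).toReal : EReal) :=
    (EReal.coe_ennreal_toReal h).symm
  have hlim : Tendsto (fun n : ℕ => ((∫ x, F (empiricalMeasure x)
      ∂(iidLaw ν (n + 1) : Measure (Fin (n + 1) → E))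
        - (InformationTheory.klDiv (ν : Measure E) (μ : Measure E)).toReal : ℝ) : EReal)) atTop
      (𝓝 ((F ν : ℝ) - relEntropy ν μ)) := by
    rw [hrel, ← EReal.coe_sub]
    exact (continuous_coe_real_ereal.tendsto _).comp
      ((tendsto_integral_comp_empiricalMeasure ν F).sub_const _)
  rw [← hlim.liminf_eq]
  refine liminf_le_liminf (Eventually.of_forall fun n => ?_)
  exact (le_log_lintegral_iidLaw F h (n + 1)).trans
    (le_iSup₂_of_le (iidLaw μ (n + 1)) (iidLaw_mem_conditionalLaws hμ _) le_rfl)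

end Limits

end UniformSanov

end

/-! ### The Laplace principle and the large deviation upper bound -/

theorem corollary5p4 {E : Type*} [TopologicalSpace E] [PolishSpace E] [MeasurableSpace E]
    [BorelSpace E] (M : Set (ProbabilityMeasure E)) (hMne : M.Nonempty)
    (hMconv : UniformSanov.IsConvex M) (hMcomp : IsCompact M) :
    (∀ F : ProbabilityMeasure E →ᵇ ℝ,
      Tendsto
        (fun n : ℕ => ⨆ μ ∈ UniformSanov.conditionalLaws M (n + 1),
          ENNReal.log (∫⁻ x, ENNReal.ofReal
            (Real.exp (((n + 1 : ℕ) : ℝ) * F (UniformSanov.empiricalMeasure x)))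
              ∂(μ : Measure (Fin (n + 1) → E))) / ((n + 1 : ℕ) : EReal))
        atTop
        (𝓝 (⨆ ν : ProbabilityMeasure E, ⨆ μ ∈ M,
          (((F ν : ℝ) : EReal) - UniformSanov.relEntropy ν μ)))) ∧
    (∀ A : Set (ProbabilityMeasure E), IsClosed A →
      limsup
        (fun n : ℕ => ⨆ μ ∈ UniformSanov.conditionalLaws M (n + 1),
          ENNReal.log ((μ : Measure (Fin (n + 1) → E))
            {x | UniformSanov.empiricalMeasure x ∈ A}) / ((n + 1 : ℕ) : EReal))
        atTop
      ≤ -(⨅ ν ∈ A, ⨅ μ ∈ M, UniformSanov.relEntropy ν μ)) := by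
  refine ⟨fun F => ?_, fun A hA => ?_⟩
  · refine tendsto_of_le_liminf_of_limsup_le
      (iSup_le fun ν => iSup₂_le fun μ hμ => UniformSanov.le_liminf F hμ) ?_
    refine EReal.le_of_forall_lt_iff_le.1 fun b hb => ?_
    -- An intermediate real `c` supplies both the strict entropy bound and the margin below `b`.
    obtain ⟨c, hSc, hcb⟩ := EReal.lt_iff_exists_real_btwn.1 hb
    have := UniformSanov.limsup_le_of_lt_relEntropy hMne hMconv hMcomp F isClosed_univ
      (EReal.coe_lt_coe_iff.1 hcb) fun ν _ μ hμ => ?_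
    · simpa using this
    · have h1 : ((F ν : ℝ) : EReal) - UniformSanov.relEntropy ν μ < c :=
        (le_iSup_of_le ν (le_iSup₂ (f := fun μ (_ : μ ∈ M) =>
          ((F ν : ℝ) : EReal) - UniformSanov.relEntropy ν μ) μ hμ)).trans_lt hSc
      by_contra! h2
      have h3 : UniformSanov.relEntropy ν μ ≠ ⊤ := (h2.trans_lt (EReal.coe_lt_top _)).ne
      have h4 : UniformSanov.relEntropy ν μ ≠ ⊥ := EReal.coe_ennreal_ne_bot _
      lift UniformSanov.relEntropy ν μ to ℝ using ⟨h3, h4⟩ with H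
      norm_cast at h1 h2
      linarith
  · refine EReal.le_of_forall_lt_iff_le.1 fun b hb => ?_
    obtain ⟨c, hSc, hcb⟩ := EReal.lt_iff_exists_real_btwn.1 hb
    have := UniformSanov.limsup_le_of_lt_relEntropy hMne hMconv hMcomp 0 hA
      (EReal.coe_lt_coe_iff.1 hcb) fun ν hν μ hμ => ?_
    · simpa using this
    · have h1 := EReal.neg_lt_comm.1 hSc
      simp only [BoundedContinuousFunction.coe_zero, Pi.zero_apply, zero_sub, EReal.coe_neg]
      exact h1.trans_le (iInf₂_le_of_le ν hν (iInf₂_le μ hμ))
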